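/- Let $T$ be a finite $3$-regular graph (loops and multiple edges allowed) drawn on the torus $\mathbb{C}/(\mathbb{Z}+i\mathbb{Z})$, such that its preimage $\hat T$ in $\mathbb{C}$ is a connected graph (this holds in particular for connected graphs of genus $1$ embedded in the torus so that all faces are discs), and let $T_i$ denote the corresponding $\mathbb{Z}^2$-periodic drawing of $\hat T$ in $\mathbb{C}$. Assume that $T$ is balanced: every vertex of $T_i$ is the barycenter, with equal weights, of its three neighbors (counted with multiplicity). For $\alpha\in\mathbb{C}$ let $T_\alpha$ be the image of $T_i$ under the $\mathbb{R}$-linear map $x+iy\mapsto x+\alpha y$. For an oriented edge $e$ of $T$, let $e_\alpha=z_2-z_1$, where $(z_1,z_2)$ are the starting point and the endpoint of any lift of $e$ to $T_\alpha$, and let $$\Sigma_\alpha(T)=\frac1{|E(T)|}\sum_{e\in E(T)}\begin{pmatrix}(\Re e_\alpha)^2&\Re e_\alpha\,\Im e_\alpha\\ \Re e_\alpha\,\Im e_\alpha&(\Im e_\alpha)^2\end{pmatrix}$$ (the summands do not depend on the orientation of $e$). 1. For every $\alpha\in\mathbb{C}\setminus\mathbb{R}$, if $(Z_n)_{n\ge0}$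 is a simple random walk on $T_\alpha$ with any initial distribution (that is, the lift to $T_\alpha$ of a simple random walk on $T$), then $n^{-1/2}Z_n$ converges in distribution, as $n\to\infty$, to a centered Gaussian variable in $\mathbb{C}\cong\mathbb{R}^2$ with covariance matrix $\Sigma_\alpha(T)$. 2. For every $\alpha\in\mathbb{C}\setminus\mathbb{R}$, the limit law is isotropic (invariant under all rotations around $0$) if and only if $\sum_{e\in E(T)}e_\alpha^2=0$, and this is also equivalent to $\Sigma_\alpha(T)$ being a scalar matrix. 3. There is a unique $\alpha_T^{\mathrm{RW}}\in\mathbb{C}$ with positive imaginary part such that, for $\alpha\in\mathbb{C}$, one has $\sum_{e\in E(T)}e_\alpha^2=0$ if and only if $\alpha\in\{\alpha_T^{\mathrm{RW}},\overline{\alpha_T^{\mathrm{RW}}}\}$. -/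

import Mathlib

open MeasureTheory ProbabilityTheory Filter

/-- A finite graph `T` (loops and multiple edges allowed) with vertex set `V` and set of oriented
edges `D`, drawn on the torus `ℂ / (ℤ + ℤ i)`. The vertex `v` is placed at the class of `pos v`, and
the oriented edge `d` lifts to a path of the plane that goes from `pos (src d)` to
`pos (src (rev d)) + a + b i`, where `(a, b) = shift d`.

Only the endpoints of the lifted edges matter for the random walk. So the shape of the edges is not
recorded, and edges are not required to be disjoint: graphs properly embedded in the torus are a
particular case. -/
structure TorusGraph (V D : Type*) where
  /-- the starting point of an oriented edge -/
  src : D → V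
  /-- the same edge with the opposite orientation -/
  rev : D → D
  rev_rev : ∀ d, rev (rev d) = d
  rev_ne : ∀ d, rev d ≠ d
  /-- a lift to the plane of the position of a vertex in the torus -/
  pos : V → ℂ
  /-- the period by which the lifted edge `d` ends away from the chosen lift of its endpoint -/
  shift : D → ℤ × ℤ
  shift_rev : ∀ d, shift (rev d) = -shift d

/-- The `ℝ`-linear map `x + i y ↦ x + α y` of the plane. -/
noncomputable def modulusMap (α z : ℂ) : ℂ := (z.re : ℂ) + α * (z.im : ℂ)

/-- The identification of the Euclidean plane `ℝ²` with `ℂ`. -/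
noncomputable def planeToComplex (x : EuclideanSpace ℝ (Fin 2)) : ℂ :=
  (x 0 : ℂ) + (x 1 : ℂ) * Complex.I

/-- A measure on the complex plane is isotropic if it is invariant under all rotations around
the origin. -/
def IsIsotropic (ν : Measure ℂ) : Prop :=
  ∀ u : ℂ, ‖u‖ = 1 → ν.map (fun z => u * z) = ν

namespace TorusGraph

variable {V D : Type*}

/-- The endpoint of an oriented edge. -/
def tgt (T : TorusGraph V D) (d : D) : V := T.src (T.rev d)

/-- The oriented edges that start from a vertex. -/
def out [Fintype D] [DecidableEq V] (T : TorusGraph V D) (v : V) : Finset D :=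
  Finset.univ.filter fun d => T.src d = v

/-- All vertices have degree `3` (a loop counts twice). -/
def IsCubic [Fintype D] [DecidableEq V] (T : TorusGraph V D) : Prop :=
  ∀ v, (T.out v).card = 3

/-- The vertices of the doubly periodic graph `T̂`, the preimage of `T` in the plane: `(v, k)` is the
translate by `k` of the chosen lift of `v`. -/
abbrev CoverVertex (_T : TorusGraph V D) : Type _ := V × (ℤ × ℤ)

/-- The endpoint of the lift of the oriented edge `d` that starts from the translate by `k` of the
chosen lift of `src d`. -/
def coverTgt (T : TorusGraph V D) (d : D) (k : ℤ × ℤ) : T.CoverVertex :=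
  (T.tgt d, k + T.shift d)

/-- The adjacency graph of `T̂`. -/
def cover (T : TorusGraph V D) : SimpleGraph T.CoverVertex :=
  SimpleGraph.fromRel fun x y => ∃ d, T.src d = x.1 ∧ T.coverTgt d x.2 = y

/-- The position of a vertex of `T̂` in the square embedding `T_i`. -/
noncomputable def squarePos (T : TorusGraph V D) (x : T.CoverVertex) : ℂ :=
  T.pos x.1 + ((x.2.1 : ℂ) + (x.2.2 : ℂ) * Complex.I)

/-- The position of a vertex of `T̂` in the embedding `T_α` of modulus `α`, which is the image of the
square embedding by `x + i y ↦ x + α y`. -/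
noncomputable def posAt (T : TorusGraph V D) (α : ℂ) (x : T.CoverVertex) : ℂ :=
  modulusMap α (T.squarePos x)

/-- In the square embedding, every vertex is the barycenter of its neighbors (with multiplicity, in
case of multiple edges). -/
def IsBalanced [Fintype D] [DecidableEq V] (T : TorusGraph V D) : Prop :=
  ∀ x : T.CoverVertex,
    T.squarePos x = (∑ d ∈ T.out x.1, T.squarePos (T.coverTgt d x.2)) / ((T.out x.1).card : ℂ)

/-- The complex number `e_α`, for an oriented edge `e` of `T`: the difference in `T_α` between the
endpoint and the starting point of a lift of `e`. -/
noncomputable def edgeVec (T : TorusGraph V D) (α : ℂ) (e : D) : ℂ :=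
  T.posAt α (T.coverTgt e 0) - T.posAt α (T.src e, 0)

/-- The matrix `Σ_α(T)`: the averages over the edges of `T` of `(Re e_α)²`, `(Re e_α) (Im e_α)` and
`(Im e_α)²`. The terms do not depend on the orientation of the edge, so that averaging over the
oriented edges gives the average over the edges. -/
noncomputable def covMatrix [Fintype D] (T : TorusGraph V D) (α : ℂ) : Matrix (Fin 2) (Fin 2) ℝ :=
  let xx : ℝ := (∑ e : D, (T.edgeVec α e).re ^ 2) / Fintype.card D
  let xy : ℝ := (∑ e : D, (T.edgeVec α e).re * (T.edgeVec α e).im) / Fintype.card D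
  let yy : ℝ := (∑ e : D, (T.edgeVec α e).im ^ 2) / Fintype.card D
  !![xx, xy; xy, yy]

/-- The transition probabilities of the simple random walk on `T̂`: one of the edges at `x` is chosen
uniformly and crossed. -/
noncomputable def stepProb [Fintype D] [DecidableEq V] (T : TorusGraph V D)
    (x y : T.CoverVertex) : ℝ :=
  (((T.out x.1).filter fun d => T.coverTgt d x.2 = y).card : ℝ) / ((T.out x.1).card : ℝ)

/-- The process `W` is a simple random walk on `T̂` (started from any distribution): it is a Markov
chain with transition probabilities `stepProb`. Its projection `n ↦ (W n).1` to `T` is a simple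
random walk on `T`, of which it is the lift. -/
structure IsSimpleRandomWalk [Fintype D] [DecidableEq V] (T : TorusGraph V D)
    {Ω : Type*} [MeasurableSpace Ω] (P : Measure Ω) (W : ℕ → Ω → T.CoverVertex) : Prop where
  measurable : ∀ n x, MeasurableSet (W n ⁻¹' {x})
  markov : ∀ (n : ℕ) (x : ℕ → T.CoverVertex),
    P.real {ω | ∀ j ≤ n + 1, W j ω = x j} =
      P.real {ω | ∀ j ≤ n, W j ω = x j} * T.stepProb (x n) (x (n + 1))

/-- The centered Gaussian distribution with covariance matrix `Σ_α(T)`, as a measure on the complex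
plane. -/
noncomputable def limitLaw [Fintype D] (T : TorusGraph V D) (α : ℂ) : Measure ℂ :=
  (multivariateGaussian 0 (T.covMatrix α)).map planeToComplex

end TorusGraph

/-! Fix a vector ξ and let x_d be the inner product of `edgeVec α d` with ξ. Conditioning step by
step (`integral_phase`) expresses the characteristic function at time n by the n-th power of the
transition operator of the finite graph `T`, twisted by the phases exp(i s x_d), at s = 1/√n.
Balancedness kills the term of order s. At order s² the local variance depends on the vertex;
solving a Poisson equation (`exists_laplacian_eq`) levels it out, so that 1 + s² g is an eigenvector
for 1 - σ s²/2 up to o(s²), where σ is the mean of x_d². Twisted operators are contractions, so n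
steps cost n · o(1/n) (`norm_pow_apply_sub_le`) and the limit is exp(-σ/2), the Gaussian
characteristic function (`charFun_limitLaw`). Lévy's continuity theorem concludes.

Isotropy means that the quadratic form in the exponent is a multiple of |ξ|², which is the vanishing
of the real and imaginary parts of ∑ e_α². As a function of α this sum is A + 2Bα + Cα², and the
real quadratic form behind it is positive definite because the connected cover has two independent
periods (`sum_sq_pos`). Hence its roots are a nonreal conjugate pair. -/

namespace TorusGraph

variable {V D : Type*}

/-! ### Edge displacements and functions invariant along edges. -/

lemma src_rev (T : TorusGraph V D) (d : D) : T.src (T.rev d) = T.tgt d := rfl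

lemma tgt_rev (T : TorusGraph V D) (d : D) : T.tgt (T.rev d) = T.src d := by
  rw [tgt, T.rev_rev]

lemma modulusMap_sub (α z w : ℂ) : modulusMap α (z - w) = modulusMap α z - modulusMap α w := by
  simp only [modulusMap, Complex.sub_re, Complex.sub_im, Complex.ofReal_sub]; ring

lemma modulusMap_zero (α : ℂ) : modulusMap α 0 = 0 := by simp [modulusMap]

lemma modulusMap_sum {ι : Type*} (α : ℂ) (s : Finset ι) (f : ι → ℂ) :
    modulusMap α (∑ i ∈ s, f i) = ∑ i ∈ s, modulusMap α (f i) := by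
  simp only [modulusMap, Complex.re_sum, Complex.im_sum, Complex.ofReal_sum, Finset.mul_sum,
    Finset.sum_add_distrib]

lemma posAt_coverTgt_sub (T : TorusGraph V D) (α : ℂ) (d : D) (k : ℤ × ℤ) :
    T.posAt α (T.coverTgt d k) - T.posAt α (T.src d, k) = T.edgeVec α d := by
  rw [edgeVec]
  simp only [posAt, ← modulusMap_sub, squarePos, coverTgt]
  congr 1
  simp only [Prod.fst_add, Prod.snd_add, Prod.fst_zero, Prod.snd_zero, zero_add]
  push_cast
  ring

/-- The displacement along an oriented edge in the square embedding. -/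
noncomputable def squareVec (T : TorusGraph V D) (d : D) : ℂ :=
  T.squarePos (T.coverTgt d 0) - T.squarePos (T.src d, 0)

lemma squarePos_coverTgt_sub (T : TorusGraph V D) (d : D) (k : ℤ × ℤ) :
    T.squarePos (T.coverTgt d k) - T.squarePos (T.src d, k) = T.squareVec d := by
  simp only [squareVec, squarePos, coverTgt, Prod.fst_add, Prod.snd_add, Prod.fst_zero,
    Prod.snd_zero, zero_add]
  push_cast
  ring

lemma edgeVec_eq (T : TorusGraph V D) (α : ℂ) (d : D) :
    T.edgeVec α d = (T.squareVec d).re + α * (T.squareVec d).im := by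
  rw [edgeVec, posAt, posAt, ← modulusMap_sub]; rfl

/-- A function on the cover that is invariant along edges is constant. -/
lemma eq_of_edge_invariant (T : TorusGraph V D) (hconn : T.cover.Connected) {β : Type*}
    (h : T.CoverVertex → β) (hinv : ∀ d k, h (T.coverTgt d k) = h (T.src d, k))
    (x y : T.CoverVertex) : h x = h y := by
  obtain ⟨p⟩ := hconn.preconnected x y
  induction p with
  | nil => rfl
  | cons hadj _ ih =>
    rw [← ih]
    rename_i u v w _
    have key : ∀ a b : T.CoverVertex, (∃ d, T.src d = a.1 ∧ T.coverTgt d a.2 = b) → h a = h b := by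
      rintro a b ⟨d, hd, rfl⟩
      rw [hinv, hd]
    rw [cover, SimpleGraph.fromRel_adj] at hadj
    rcases hadj.2 with h1 | h1
    · exact key _ _ h1
    · exact (key _ _ h1).symm

lemma eq_of_tgt_eq_src (T : TorusGraph V D) (hconn : T.cover.Connected) {β : Type*}
    (g : V → β) (hg : ∀ d, g (T.tgt d) = g (T.src d)) (u v : V) : g u = g v :=
  T.eq_of_edge_invariant hconn (fun x => g x.1) (fun d _ => hg d) (u, 0) (v, 0)

/-! ### The Laplacian and the Poisson equation on `T`. -/

section Fin

variable [Fintype D] [DecidableEq V]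

lemma mem_out (T : TorusGraph V D) (v : V) (d : D) : d ∈ T.out v ↔ T.src d = v := by simp [out]

lemma sum_out [Fintype V] (T : TorusGraph V D) {M : Type*} [AddCommMonoid M] (f : D → M) :
    ∑ v, ∑ d ∈ T.out v, f d = ∑ d, f d := by
  simp only [out]
  exact Finset.sum_fiberwise Finset.univ T.src f

omit [DecidableEq V] in
lemma sum_rev (T : TorusGraph V D) {M : Type*} [AddCommMonoid M] (f : D → M) :
    ∑ d, f (T.rev d) = ∑ d, f d :=
  Equiv.sum_comp (Function.Involutive.toPerm T.rev T.rev_rev) f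

lemma card_eq [Fintype V] (T : TorusGraph V D) (hcubic : T.IsCubic) :
    Fintype.card D = 3 * Fintype.card V := by
  have := T.sum_out (fun _ => 1)
  simp only [Finset.sum_const, hcubic _, smul_eq_mul, Finset.card_univ] at this
  linarith

/-- Being a barycenter is preserved by real-linear maps, so balancedness passes from the square
drawing to every modulus. This is the martingale property of the walk. -/
lemma sum_out_edgeVec (T : TorusGraph V D) (hcubic : T.IsCubic) (hbal : T.IsBalanced)
    (α : ℂ) (v : V) : ∑ d ∈ T.out v, T.edgeVec α d = 0 := by
  have h := hbal (v, 0)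
  simp only [hcubic v] at h
  have h2 : ∑ d ∈ T.out v, (T.squarePos (T.coverTgt d 0) - T.squarePos (T.src d, 0)) = 0 := by
    have h3 : ∀ d ∈ T.out v, T.squarePos (T.src d, 0) = T.squarePos (v, 0) := by
      intro d hd
      rw [(T.mem_out v d).1 hd]
    rw [Finset.sum_sub_distrib, Finset.sum_congr rfl h3, Finset.sum_const, hcubic v, h]
    push_cast
    simp only [nsmul_eq_mul]
    push_cast
    ring
  simp only [edgeVec, posAt, ← modulusMap_sub]
  rw [← modulusMap_sum, h2, modulusMap_zero]

/-- The combinatorial Laplacian of `T`. -/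
noncomputable def laplacian (T : TorusGraph V D) : (V → ℝ) →ₗ[ℝ] (V → ℝ) where
  toFun g v := ∑ d ∈ T.out v, (g (T.tgt d) - g v)
  map_add' f g := by
    ext v
    simp only [Pi.add_apply, ← Finset.sum_add_distrib]
    exact Finset.sum_congr rfl fun _ _ => by ring
  map_smul' c f := by
    ext v
    simp only [Pi.smul_apply, smul_eq_mul, RingHom.id_apply, Finset.mul_sum]
    exact Finset.sum_congr rfl fun _ _ => by ring

lemma sum_mul_laplacian [Fintype V] (T : TorusGraph V D) (f g : V → ℝ) :
    ∑ v, f v * T.laplacian g v = ∑ d, f (T.src d) * (g (T.tgt d) - g (T.src d)) := by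
  rw [← T.sum_out]
  refine Finset.sum_congr rfl fun v _ => ?_
  simp only [laplacian, LinearMap.coe_mk, AddHom.coe_mk, Finset.mul_sum]
  refine Finset.sum_congr rfl fun d hd => ?_
  rw [(T.mem_out v d).1 hd]

lemma sum_laplacian [Fintype V] (T : TorusGraph V D) (g : V → ℝ) : ∑ v, T.laplacian g v = 0 := by
  have h := T.sum_mul_laplacian (fun _ => 1) g
  simp only [one_mul, Finset.sum_sub_distrib] at h
  rw [h, ← T.sum_rev (fun d => g (T.src d))]
  simp [src_rev]

/-- Summation by parts: reversing all edges swaps sources and targets, and adding the two resulting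
expressions completes the square. -/
lemma two_mul_energy [Fintype V] (T : TorusGraph V D) (g : V → ℝ) :
    ∑ d, (g (T.tgt d) - g (T.src d)) ^ 2 = -2 * ∑ v, g v * T.laplacian g v := by
  have h1 := T.sum_mul_laplacian g g
  have h2 : ∑ d, g (T.src d) * (g (T.tgt d) - g (T.src d)) =
      ∑ d, g (T.tgt d) * (g (T.src d) - g (T.tgt d)) := by
    rw [← T.sum_rev]
    simp [src_rev, tgt_rev]
  have h3 : ∑ d, (g (T.tgt d) - g (T.src d)) ^ 2 =
      -(∑ d, g (T.src d) * (g (T.tgt d) - g (T.src d)) +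
        ∑ d, g (T.tgt d) * (g (T.src d) - g (T.tgt d))) := by
    rw [← Finset.sum_add_distrib, ← Finset.sum_neg_distrib]
    exact Finset.sum_congr rfl fun _ _ => by ring
  rw [h3, ← h2, h1]; ring

lemma const_of_laplacian_eq_zero [Fintype V] (T : TorusGraph V D) (hconn : T.cover.Connected)
    (g : V → ℝ) (hg : T.laplacian g = 0) (u v : V) : g u = g v := by
  refine T.eq_of_tgt_eq_src hconn g (fun d => ?_) u v
  have h := T.two_mul_energy g
  rw [hg] at h
  simp only [Pi.zero_apply, mul_zero, Finset.sum_const_zero] at h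
  have := (Finset.sum_eq_zero_iff_of_nonneg (fun d _ => sq_nonneg _)).1 h d (Finset.mem_univ d)
  exact sub_eq_zero.1 (pow_eq_zero_iff (two_ne_zero) |>.1 this)

/-- The Poisson equation on `T` is solvable for functions of zero sum. -/
lemma exists_laplacian_eq [Fintype V] (T : TorusGraph V D) (hconn : T.cover.Connected)
    (f : V → ℝ) (hf : ∑ v, f v = 0) : ∃ g, T.laplacian g = f := by
  have : Nonempty V := ⟨hconn.nonempty.some.1⟩
  have hV : (Fintype.card V : ℝ) ≠ 0 := by simp
  -- The Laplacian has the constants as kernel and takes values of zero sum. Adding the rank-one map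
  -- `J` makes it injective, hence surjective, and `J` vanishes on the solution when the right-hand
  -- side has zero sum.
  let J : (V → ℝ) →ₗ[ℝ] (V → ℝ) := LinearMap.pi fun _ => ∑ v, LinearMap.proj v
  have hJ : ∀ g v, J g v = ∑ w, g w := fun g v => by simp [J]
  have hsum : ∀ g, ∑ v, (T.laplacian + J) g v = Fintype.card V * ∑ w, g w := by
    intro g
    simp only [LinearMap.add_apply, Pi.add_apply, Finset.sum_add_distrib, T.sum_laplacian, hJ]
    simp
  have hzero : ∀ g, ∑ v, (T.laplacian + J) g v = 0 → J g = 0 := by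
    intro g hg
    rw [hsum] at hg
    ext v
    rw [hJ]
    simpa [hV] using hg
  have hinj : Function.Injective (T.laplacian + J) := by
    rw [injective_iff_map_eq_zero]
    intro g hg
    have h1 : J g = 0 := hzero g (by simp [hg])
    have h2 : T.laplacian g = 0 := by simpa [h1] using hg
    have h3 := T.const_of_laplacian_eq_zero hconn g h2
    ext v
    have h4 := hJ g v
    rw [h1, Finset.sum_congr rfl fun w _ => h3 w v] at h4
    simpa [hV] using h4.symm
  obtain ⟨g, hg⟩ := (LinearMap.injective_iff_surjective.1 hinj) f
  refine ⟨g, ?_⟩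
  have h1 : J g = 0 := hzero g (by rw [hg, hf])
  simpa [h1] using hg

end Fin

end TorusGraph

/-! ### Powers of contractions and a Taylor estimate. -/

lemma norm_pow_apply_le {E : Type*} [NormedAddCommGroup E] [NormedSpace ℂ E]
    (M : E →ₗ[ℂ] E) (hM : ∀ h, ‖M h‖ ≤ ‖h‖) (n : ℕ) (h : E) : ‖(M ^ n) h‖ ≤ ‖h‖ := by
  induction n generalizing h with
  | zero => simp
  | succ n ih => rw [pow_succ, Module.End.mul_apply]; exact (ih _).trans (hM h)

/-- The defect of an approximate eigenvector accumulates at most linearly, by telescoping: neither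
`M` nor `c` amplifies the error of a single step. -/
lemma norm_pow_apply_sub_le {E : Type*} [NormedAddCommGroup E] [NormedSpace ℂ E]
    (M : E →ₗ[ℂ] E) (hM : ∀ h, ‖M h‖ ≤ ‖h‖) (c : ℂ) (hc : ‖c‖ ≤ 1) (h : E) (n : ℕ) :
    ‖(M ^ n) h - c ^ n • h‖ ≤ n * ‖M h - c • h‖ := by
  induction n with
  | zero => simp
  | succ n ih =>
    have h1 : (M ^ (n + 1)) h - c ^ (n + 1) • h =
        (M ^ n) (M h - c • h) + c • ((M ^ n) h - c ^ n • h) := by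
      rw [pow_succ, Module.End.mul_apply, map_sub, map_smul, smul_sub, smul_smul, ← pow_succ']
      abel
    rw [h1]
    calc _ ≤ ‖(M ^ n) (M h - c • h)‖ + ‖c • ((M ^ n) h - c ^ n • h)‖ := norm_add_le _ _
      _ ≤ ‖M h - c • h‖ + 1 * (n * ‖M h - c • h‖) := by
        rw [norm_smul]
        gcongr
        exact norm_pow_apply_le M hM _ _
      _ = _ := by push_cast; ring

lemma exp_taylor_isLittleO (x : ℝ) :
    (fun s : ℝ => Complex.exp (s * x * Complex.I) -
      (1 + s * x * Complex.I - (s * x) ^ 2 / 2)) =o[nhds 0] fun s : ℝ => s ^ 2 := by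
  have h : (fun s : ℝ => Complex.exp (s * x * Complex.I) -
      (1 + s * x * Complex.I - (s * x) ^ 2 / 2)) =O[nhds 0] fun s : ℝ => s ^ 3 := by
    refine Asymptotics.IsBigO.of_bound (|x| ^ 3 * Real.exp |x|) ?_
    filter_upwards [Metric.ball_mem_nhds (0 : ℝ) one_pos] with s hs
    have hs : |s| < 1 := by simpa using hs
    have h1 := Complex.norm_exp_sub_sum_le_norm_mul_exp (s * x * Complex.I) 3
    have h2 : ∑ m ∈ Finset.range 3, ((s : ℂ) * x * Complex.I) ^ m / m.factorial =
        1 + s * x * Complex.I - (s * x) ^ 2 / 2 := by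
      simp [Finset.sum_range_succ, mul_pow, Nat.factorial]
      ring
    have h3 : ‖(s : ℂ) * x * Complex.I‖ = |s| * |x| := by simp
    rw [h2, h3] at h1
    refine h1.trans ?_
    rw [Real.norm_eq_abs, abs_pow, mul_pow]
    have : Real.exp (|s| * |x|) ≤ Real.exp |x| :=
      Real.exp_le_exp.2 (mul_le_of_le_one_left (abs_nonneg x) hs.le)
    calc _ ≤ |s| ^ 3 * |x| ^ 3 * Real.exp |x| := by gcongr
      _ = _ := by ring
  exact h.trans_isLittleO (Asymptotics.isLittleO_pow_pow (by norm_num))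

/-! ### The twisted transition operator in the diffusive scaling. -/

namespace TorusGraph

variable {V D : Type*} [Fintype D] [DecidableEq V]

/-- The transition operator of the walk on `T`, twisted by the phases `exp (i s x_d)`. -/
noncomputable def twisted (T : TorusGraph V D) (x : D → ℝ) (s : ℝ) : (V → ℂ) →ₗ[ℂ] (V → ℂ) where
  toFun h v := (∑ d ∈ T.out v, Complex.exp (s * x d * Complex.I) * h (T.tgt d)) / 3
  map_add' f g := by
    ext v
    simp only [Pi.add_apply, mul_add, Finset.sum_add_distrib, add_div]
  map_smul' c f := by
    ext v
    simp only [Pi.smul_apply, smul_eq_mul, RingHom.id_apply, mul_div_assoc', Finset.mul_sum]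
    congr 1
    exact Finset.sum_congr rfl fun _ _ => by ring

lemma twisted_apply (T : TorusGraph V D) (x : D → ℝ) (s : ℝ) (h : V → ℂ) (v : V) :
    T.twisted x s h v = (∑ d ∈ T.out v, Complex.exp (s * x d * Complex.I) * h (T.tgt d)) / 3 := rfl

variable [Fintype V]

lemma norm_twisted_le (T : TorusGraph V D) (hcubic : T.IsCubic) (x : D → ℝ) (s : ℝ) (h : V → ℂ) :
    ‖T.twisted x s h‖ ≤ ‖h‖ := by
  refine (pi_norm_le_iff_of_nonneg (norm_nonneg h)).2 fun v => ?_
  rw [twisted_apply, norm_div]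
  have h1 : ‖∑ d ∈ T.out v, Complex.exp (s * x d * Complex.I) * h (T.tgt d)‖ ≤
      ∑ d ∈ T.out v, ‖h‖ := by
    refine norm_sum_le_of_le _ fun d _ => ?_
    rw [norm_mul, ← Complex.ofReal_mul, Complex.norm_exp_ofReal_mul_I, one_mul]
    exact norm_le_pi_norm h _
  rw [Finset.sum_const, hcubic v] at h1
  rw [Complex.norm_ofNat, div_le_iff₀ (by norm_num)]
  simpa [mul_comm] using h1

/-- The corrector `1 + s² g` is an eigenvector of the twisted operator up to `o(s²)`. -/
lemma twisted_corrector_isLittleO (T : TorusGraph V D) (hcubic : T.IsCubic) (x : D → ℝ)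
    (hx : ∀ v, ∑ d ∈ T.out v, x d = 0) (σ : ℝ) (g : V → ℝ)
    (hg : ∀ v, T.laplacian g v = (∑ d ∈ T.out v, x d ^ 2 - 3 * σ) / 2) :
    (fun s : ℝ => T.twisted x s (fun v => 1 + s ^ 2 * g v) -
      (1 - σ / 2 * s ^ 2 : ℂ) • (fun v => 1 + s ^ 2 * g v : V → ℂ)) =o[nhds 0]
      fun s : ℝ => s ^ 2 := by
  rw [Asymptotics.isLittleO_pi]
  intro v
  have hpow : ∀ (c : ℂ) (k : ℕ), 2 < k → (fun s : ℝ => c * (s : ℂ) ^ k) =o[nhds 0]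
      fun s : ℝ => s ^ 2 := by
    intro c k hk
    refine Asymptotics.IsLittleO.const_mul_left ?_ c
    rw [← Asymptotics.isLittleO_norm_left]
    have : (fun s : ℝ => ‖(s : ℂ) ^ k‖) = fun s : ℝ => ‖s ^ k‖ := by ext s; simp
    rw [this, Asymptotics.isLittleO_norm_left]
    exact Asymptotics.isLittleO_pow_pow hk
  have hterm : ∀ d, (fun s : ℝ => (Complex.exp (s * x d * Complex.I) -
      (1 + s * x d * Complex.I - (s * x d) ^ 2 / 2)) * (1 + s ^ 2 * g (T.tgt d)))
      =o[nhds 0] fun s : ℝ => s ^ 2 := by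
    intro d
    have h1 : (fun s : ℝ => (1 + s ^ 2 * g (T.tgt d) : ℂ)) =O[nhds 0] fun _ => (1 : ℝ) := by
      have hcont : Continuous fun s : ℝ => (1 + s ^ 2 * g (T.tgt d) : ℂ) := by fun_prop
      exact (hcont.tendsto 0).isBigO_one ℝ
    simpa using (exp_taylor_isLittleO (x d)).mul_isBigO h1
  have hsum := Asymptotics.IsLittleO.fun_sum (s := T.out v) fun d _ => hterm d
  -- The whole error: the Taylor remainders, then the s³ and s⁴ terms of the expanded product. Order
  -- s cancels by `e1`, and order s² by the Poisson equation `e2`.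
  have hs := (((hsum.const_mul_left (1 / 3)).add
    (hpow ((∑ d ∈ T.out v, (x d * g (T.tgt d) : ℂ)) / 3 * Complex.I) 3 (by norm_num))).add
    (hpow (-(∑ d ∈ T.out v, (x d ^ 2 * g (T.tgt d) : ℂ)) / 6 + σ / 2 * g v) 4 (by norm_num)))
  refine hs.congr_left fun s => ?_
  have e1 : (∑ d ∈ T.out v, (x d : ℂ)) = 0 := by exact_mod_cast hx v
  have e2 : (∑ d ∈ T.out v, (g (T.tgt d) : ℂ)) - 3 * g v =
      (∑ d ∈ T.out v, (x d : ℂ) ^ 2 - 3 * σ) / 2 := by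
    have := hg v
    simp only [laplacian, LinearMap.coe_mk, AddHom.coe_mk, Finset.sum_sub_distrib,
      Finset.sum_const, hcubic v, nsmul_eq_mul] at this
    exact_mod_cast this
  have e3 : (∑ d ∈ T.out v, (Complex.exp (s * x d * Complex.I) -
      (1 + s * x d * Complex.I - (s * x d) ^ 2 / 2)) * (1 + s ^ 2 * g (T.tgt d))) =
      (∑ d ∈ T.out v, Complex.exp (s * x d * Complex.I) * (1 + s ^ 2 * g (T.tgt d)))
      - (3 + s ^ 2 * (∑ d ∈ T.out v, (g (T.tgt d) : ℂ))
        + s * Complex.I * (∑ d ∈ T.out v, (x d : ℂ))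
        + s ^ 3 * Complex.I * (∑ d ∈ T.out v, (x d * g (T.tgt d) : ℂ))
        - s ^ 2 / 2 * (∑ d ∈ T.out v, (x d : ℂ) ^ 2)
        - s ^ 4 / 2 * (∑ d ∈ T.out v, (x d ^ 2 * g (T.tgt d) : ℂ))) := by
    have e4 : (3 : ℂ) = ∑ d ∈ T.out v, 1 := by simp [hcubic v]
    rw [e4]
    simp only [Finset.mul_sum, ← Finset.sum_add_distrib, ← Finset.sum_sub_distrib]
    exact Finset.sum_congr rfl fun _ _ => by ring
  rw [e3, e1]
  simp only [Pi.sub_apply, Pi.smul_apply, smul_eq_mul, twisted_apply]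
  linear_combination (-(s : ℂ) ^ 2 / 3) * e2

/-- Convergence of the iterates of the twisted operator, in the diffusive scaling. -/
lemma tendsto_twisted_pow (T : TorusGraph V D) (hcubic : T.IsCubic) (hconn : T.cover.Connected)
    (x : D → ℝ) (hx : ∀ v, ∑ d ∈ T.out v, x d = 0) (v : V) :
    Tendsto (fun n : ℕ => ((T.twisted x (Real.sqrt n)⁻¹) ^ n) 1 v) atTop
      (nhds (Complex.exp (-(((∑ d, x d ^ 2) / Fintype.card D / 2 : ℝ) : ℂ)))) := by
  have : Nonempty V := ⟨v⟩
  have hV : (Fintype.card V : ℝ) ≠ 0 := by simp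
  set σ : ℝ := (∑ d, x d ^ 2) / Fintype.card D with hσ
  -- The right-hand side has zero sum because σ is the mean over the oriented edges, which number
  -- three per vertex.
  obtain ⟨g, hg⟩ := T.exists_laplacian_eq hconn
    (fun v => (∑ d ∈ T.out v, x d ^ 2 - 3 * σ) / 2) (by
      rw [← Finset.sum_div, Finset.sum_sub_distrib, T.sum_out, hσ, T.card_eq hcubic]
      simp only [Finset.sum_const, Finset.card_univ, nsmul_eq_mul]
      push_cast
      field_simp
      ring)
  have hlo := T.twisted_corrector_isLittleO hcubic x hx σ g (fun v => congrFun hg v)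
  have hs0 : Tendsto (fun n : ℕ => (Real.sqrt n)⁻¹) atTop (nhds 0) :=
    (Real.tendsto_sqrt_atTop.comp tendsto_natCast_atTop_atTop).inv_tendsto_atTop
  set s : ℕ → ℝ := fun n => (Real.sqrt n)⁻¹ with hs
  -- Also true at n = 0, where both sides are 0 by convention.
  have hsq : ∀ n : ℕ, s n ^ 2 = (n : ℝ)⁻¹ := fun n => by simp [hs, inv_pow]
  set h : ℕ → V → ℂ := fun n v => 1 + (s n : ℂ) ^ 2 * g v
  set c : ℕ → ℂ := fun n => 1 - σ / 2 * (s n : ℂ) ^ 2 with hc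
  have hlim_h : Tendsto h atTop (nhds 1) := by
    rw [tendsto_pi_nhds]
    intro w
    have : Continuous fun s : ℝ => (1 + (s : ℂ) ^ 2 * g w : ℂ) := by fun_prop
    simpa [Function.comp_def] using (this.tendsto 0).comp hs0
  have hlim_c : Tendsto (fun n => c n ^ n) atTop
      (nhds (Complex.exp (-((σ / 2 : ℝ) : ℂ)))) := by
    refine (Complex.tendsto_one_add_div_pow_exp (-((σ / 2 : ℝ) : ℂ))).congr fun n => ?_
    have : ((s n : ℂ)) ^ 2 = (n : ℂ)⁻¹ := by
      rw [← Complex.ofReal_pow, hsq n, Complex.ofReal_inv, Complex.ofReal_natCast]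
    simp only [hc, this]
    push_cast
    ring
  have hσ0 : 0 ≤ σ := by positivity
  have hc1 : ∀ᶠ n in atTop, ‖c n‖ ≤ 1 := by
    have h1 : Tendsto (fun n => 1 - σ / 2 * s n ^ 2) atTop (nhds 1) := by
      have : Continuous fun s : ℝ => 1 - σ / 2 * s ^ 2 := by fun_prop
      simpa [Function.comp_def] using (this.tendsto 0).comp hs0
    filter_upwards [h1.eventually (lt_mem_nhds zero_lt_one)] with n hn
    have : c n = ((1 - σ / 2 * s n ^ 2 : ℝ) : ℂ) := by simp [hc]
    rw [this, Complex.norm_real, Real.norm_of_nonneg hn.le]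
    have : 0 ≤ σ / 2 * s n ^ 2 := by positivity
    linarith
  have hr : Tendsto (fun n : ℕ => (n : ℝ) * ‖T.twisted x (s n) (h n) - c n • h n‖) atTop
      (nhds 0) := by
    have h1 := (hlo.comp_tendsto hs0).norm_left.tendsto_div_nhds_zero
    refine h1.congr fun n => ?_
    simp only [Function.comp_def, hsq]
    rw [div_inv_eq_mul, mul_comm]
  have hM := fun n => norm_pow_apply_sub_le (T.twisted x (s n)) (T.norm_twisted_le hcubic x (s n))
  have hmain : Tendsto (fun n : ℕ => ((T.twisted x (s n)) ^ n) (h n) - c n ^ n • h n) atTop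
      (nhds 0) := by
    refine squeeze_zero_norm' ?_ hr
    filter_upwards [hc1] with n hn
    exact hM n (c n) hn (h n) n
  have hrest : Tendsto (fun n : ℕ => ((T.twisted x (s n)) ^ n) (1 - h n)) atTop (nhds 0) := by
    refine squeeze_zero_norm
      (fun n => norm_pow_apply_le _ (T.norm_twisted_le hcubic x (s n)) n _) ?_
    simpa using ((tendsto_const_nhds (x := (1 : V → ℂ))).sub hlim_h).norm
  -- With `M` the twisted operator: Mⁿ 1 = (Mⁿ h - cⁿ h) + Mⁿ (1 - h) + cⁿ h.
  have htot := (hmain.add hrest).add (hlim_c.smul hlim_h)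
  have htot2 := (tendsto_pi_nhds.1 htot) v
  simp only [zero_add, Pi.smul_apply, Pi.one_apply, smul_eq_mul, mul_one, Pi.zero_apply,
    Pi.add_apply] at htot2
  refine htot2.congr fun n => ?_
  rw [map_sub]
  simp [hs]

end TorusGraph

/-! ### From the Markov property on paths to one-step expectations. -/

namespace TorusGraph

variable {V D : Type*} [Fintype V] [Fintype D] [DecidableEq V]

namespace IsSimpleRandomWalk

variable {T : TorusGraph V D} {Ω : Type*} [MeasurableSpace Ω] {P : Measure Ω}
  {W : ℕ → Ω → T.CoverVertex}

lemma measurable_comp (hW : T.IsSimpleRandomWalk P W) {β : Type*} [MeasurableSpace β]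
    (f : T.CoverVertex → β) (n : ℕ) : Measurable fun ω => f (W n ω) := by
  let _ : MeasurableSpace T.CoverVertex := ⊤
  have h1 : Measurable (W n) := measurable_to_countable' (hW.measurable n)
  exact (measurable_from_top (f := f)).comp h1

/-- The Markov property is given for entire paths, so the past must be summed out. There are
countably many pasts, and the sum is performed by comparing two measures on the discrete space of
pasts, singleton by singleton, then taking total masses. -/
lemma real_step [IsFiniteMeasure P] (hW : T.IsSimpleRandomWalk P W) (n : ℕ)
    (x y : T.CoverVertex) :
    P.real {ω | W n ω = x ∧ W (n + 1) ω = y} = P.real {ω | W n ω = x} * T.stepProb x y := by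
  let _ : MeasurableSpace (Fin (n + 1) → T.CoverVertex) := ⊤
  have hmeas : ∀ n x, MeasurableSet {ω | W n ω = x} := hW.measurable
  let F : Ω → Fin (n + 1) → T.CoverVertex := fun ω j => W j ω
  have hF : Measurable F := by
    refine measurable_to_countable' fun z => ?_
    have : F ⁻¹' {z} = ⋂ j : Fin (n + 1), {ω | W j ω = z j} := by
      ext ω
      simp [F, funext_iff]
    rw [this]
    exact MeasurableSet.iInter fun j => hmeas j (z j)
  have hsp : 0 ≤ T.stepProb x y := by unfold stepProb; positivity
  have key : (P.restrict {ω | W n ω = x ∧ W (n + 1) ω = y}).map F =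
      (T.stepProb x y).toNNReal • (P.restrict {ω | W n ω = x}).map F := by
    refine Measure.ext_of_singleton fun z => ?_
    rw [Measure.smul_apply, Measure.map_apply hF (measurableSet_singleton z),
      Measure.map_apply hF (measurableSet_singleton z),
      Measure.restrict_apply (hF (measurableSet_singleton z)),
      Measure.restrict_apply (hF (measurableSet_singleton z))]
    by_cases hz : z (Fin.last n) = x
    -- The past `z` extended by `y`; only the value at n + 1 of this extension matters.
    · let p : ℕ → T.CoverVertex := fun j => if hj : j < n + 1 then z ⟨j, hj⟩ else y
      have hp : ∀ j (hj : j < n + 1), p j = z ⟨j, hj⟩ := fun j hj => dif_pos hj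
      have hpn : p n = x := by rw [hp n (Nat.lt_succ_self n)]; exact hz
      have hpn1 : p (n + 1) = y := by simp [p]
      have hm := hW.markov n p
      rw [hpn, hpn1] at hm
      have s2 : F ⁻¹' {z} ∩ {ω | W n ω = x} = {ω | ∀ j ≤ n, W j ω = p j} := by
        ext ω
        simp only [Set.mem_inter_iff, Set.mem_preimage, Set.mem_singleton_iff, Set.mem_ofPred_eq]
        constructor
        · rintro ⟨h1, -⟩ j hj
          rw [hp j (Nat.lt_succ_of_le hj), ← h1]
        · intro h
          refine ⟨funext fun j => ?_, (h n le_rfl).trans hpn⟩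
          rw [← hp j j.2]
          exact h j (Nat.le_of_lt_succ j.2)
      have s1 : F ⁻¹' {z} ∩ {ω | W n ω = x ∧ W (n + 1) ω = y} =
          {ω | ∀ j ≤ n + 1, W j ω = p j} := by
        have : F ⁻¹' {z} ∩ {ω | W n ω = x ∧ W (n + 1) ω = y} =
            {ω | ∀ j ≤ n, W j ω = p j} ∩ {ω | W (n + 1) ω = y} := by
          rw [← s2]; ext ω; simp only [Set.mem_inter_iff, Set.mem_ofPred_eq]; tauto
        rw [this]
        ext ω
        simp only [Set.mem_inter_iff, Set.mem_ofPred_eq]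
        constructor
        · rintro ⟨h1, h2⟩ j hj
          rcases Nat.le_or_eq_of_le_succ hj with h | rfl
          · exact h1 j h
          · exact h2.trans hpn1.symm
        · intro h
          exact ⟨fun j hj => h j (by omega), (h _ le_rfl).trans hpn1⟩
      rw [s1, s2, ← ENNReal.toReal_eq_toReal_iff' (measure_ne_top _ _)
        (by simp [ENNReal.smul_def, ENNReal.mul_eq_top])]
      simpa [Measure.real, ENNReal.smul_def, hsp, mul_comm] using hm
    · have hempty : F ⁻¹' {z} ∩ {ω | W n ω = x} = ∅ := by
        ext ω
        simp only [Set.mem_inter_iff, Set.mem_preimage, Set.mem_singleton_iff, Set.mem_ofPred_eq,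
          Set.mem_empty_iff_false, iff_false, not_and]
        rintro rfl h
        exact hz h
      have hempty2 : F ⁻¹' {z} ∩ {ω | W n ω = x ∧ W (n + 1) ω = y} = ∅ :=
        Set.subset_eq_empty (Set.inter_subset_inter_right _ fun _ h => h.1) hempty
      rw [hempty, hempty2]
      simp
  have h2 := congrArg (fun μ => μ Set.univ) key
  simp only [Measure.smul_apply, Measure.map_apply hF MeasurableSet.univ, Set.preimage_univ,
    Measure.restrict_apply MeasurableSet.univ, Set.univ_inter] at h2
  rw [Measure.real, h2]
  simp [Measure.real, ENNReal.smul_def, hsp, mul_comm]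

/-- One step of the walk, for a bounded observable. -/
lemma integral_step [IsFiniteMeasure P] (hcubic : T.IsCubic) (hW : T.IsSimpleRandomWalk P W)
    (f : T.CoverVertex → ℂ) (C : ℝ) (hf : ∀ x, ‖f x‖ ≤ C) (n : ℕ) :
    ∫ ω, f (W (n + 1) ω) ∂P =
      ∫ ω, (∑ d ∈ T.out (W n ω).1, f (T.coverTgt d (W n ω).2)) / 3 ∂P := by
  let _ : MeasurableSpace T.CoverVertex := ⊤
  have hm : ∀ n, Measurable (W n) := fun n => hW.measurable_comp id n
  let κ : Kernel T.CoverVertex T.CoverVertex := Kernel.ofFunOfCountable fun x =>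
    ∑ d ∈ T.out x.1, (3⁻¹ : NNReal) • Measure.dirac (T.coverTgt d x.2)
  have hκ : ∀ x, κ x = ∑ d ∈ T.out x.1, (3⁻¹ : NNReal) • Measure.dirac (T.coverTgt d x.2) :=
    fun _ => rfl
  have hprob : IsMarkovKernel κ := by
    refine ⟨fun x => ⟨?_⟩⟩
    rw [hκ, Measure.finsetSum_apply]
    simp only [Measure.smul_apply, measure_univ, Finset.sum_const, ENNReal.smul_def]
    rw [hcubic x.1, nsmul_eq_mul, smul_eq_mul, mul_one, ENNReal.coe_inv three_ne_zero]
    exact ENNReal.mul_inv_cancel (by simp) (by simp)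
  have hκm : ∀ x y, (κ x).real {y} = T.stepProb x y := by
    intro x y
    rw [hκ, stepProb, hcubic, Finset.card_filter, Measure.real, Measure.finsetSum_apply,
      ENNReal.toReal_sum fun d _ => measure_ne_top _ _]
    push_cast
    rw [Finset.sum_div]
    refine Finset.sum_congr rfl fun d _ => ?_
    by_cases h : T.coverTgt d x.2 = y
    · simp [h, ENNReal.smul_def]
    · simp [h]
  -- Split according to the position at time n.
  have hlaw : P.map (W (n + 1)) = κ ∘ₘ P.map (W n) := by
    refine Measure.ext_of_singleton fun y => ?_
    rw [Measure.bind_apply (measurableSet_singleton y) κ.aemeasurable, lintegral_countable',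
      Measure.map_apply (hm _) (measurableSet_singleton y)]
    have hunion : W (n + 1) ⁻¹' {y} = ⋃ x, {ω | W n ω = x ∧ W (n + 1) ω = y} := by
      ext ω; simp
    rw [hunion, measure_iUnion]
    · refine tsum_congr fun x => ?_
      rw [Measure.map_apply (hm _) (measurableSet_singleton x)]
      have h1 := hW.real_step n x y
      rw [← hκm] at h1
      rw [← ENNReal.toReal_eq_toReal_iff' (measure_ne_top _ _)
        (ENNReal.mul_ne_top (measure_ne_top _ _) (measure_ne_top _ _)), ENNReal.toReal_mul, mul_comm]
      exact h1
    · intro x x' hxx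
      refine Set.disjoint_left.2 fun ω h1 h2 => hxx (h1.1.symm.trans h2.1)
    · exact fun x => (hW.measurable n x).inter (hW.measurable (n + 1) y)
  have hfm : StronglyMeasurable f := StronglyMeasurable.of_discrete
  have h1 : ∫ ω, f (W (n + 1) ω) ∂P = ∫ x, f x ∂(κ ∘ₘ P.map (W n)) := by
    rw [← hlaw, integral_map (hm _).aemeasurable hfm.aestronglyMeasurable]
  have hfinite : IsFiniteMeasure (κ ∘ₘ P.map (W n)) := by
    rw [← hlaw]; infer_instance
  have h2 : ∫ x, f x ∂(κ ∘ₘ P.map (W n)) = ∫ x, ∫ y, f y ∂κ x ∂(P.map (W n)) := by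
    have := ProbabilityTheory.Kernel.integral_comp (η := κ) (κ := Kernel.const Unit (P.map (W n)))
      (a := ()) (f := f) (by
        rw [Kernel.comp_apply]
        exact Integrable.of_bound hfm.aestronglyMeasurable C (ae_of_all _ hf))
    rwa [Kernel.comp_apply, Kernel.const_apply] at this
  rw [h1, h2, integral_map (hm _).aemeasurable
    (StronglyMeasurable.of_discrete).aestronglyMeasurable]
  refine integral_congr_ae (ae_of_all _ fun ω => ?_)
  simp only [hκ]
  rw [integral_finsetSum_measure, Finset.sum_div]
  · refine Finset.sum_congr rfl fun d _ => ?_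
    rw [integral_smul_nnreal_measure, integral_dirac, NNReal.smul_def, Complex.real_smul]
    push_cast
    ring
  · intro d _
    exact (integrable_dirac (by simp)).smul_measure_nnreal

end IsSimpleRandomWalk

end TorusGraph

/-! ### Characteristic functions and the central limit theorem. -/

open scoped RealInnerProductSpace in
lemma complex_inner_eq (z w : ℂ) : ⟪z, w⟫ = z.re * w.re + z.im * w.im := by
  simp [Complex.inner, mul_comm]

namespace TorusGraph

variable {V D : Type*} [Fintype V] [Fintype D] [DecidableEq V]

open scoped RealInnerProductSpace

omit [Fintype V] in
lemma sum_out_inner_edgeVec (T : TorusGraph V D) (hcubic : T.IsCubic) (hbal : T.IsBalanced)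
    (α ξ : ℂ) (v : V) : ∑ d ∈ T.out v, ⟪T.edgeVec α d, ξ⟫ = 0 := by
  rw [← sum_inner, T.sum_out_edgeVec hcubic hbal, inner_zero_left]

namespace IsSimpleRandomWalk

variable {T : TorusGraph V D} {Ω : Type*} [MeasurableSpace Ω] {P : Measure Ω}
  {W : ℕ → Ω → T.CoverVertex}

/-- Crossing `d` multiplies the phase by exp(i s x_d), so integrating out the last step applies the
twisted operator to `h`. The induction therefore needs arbitrary `h`. -/
lemma integral_phase [IsFiniteMeasure P] (hcubic : T.IsCubic) (hW : T.IsSimpleRandomWalk P W)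
    (α ξ : ℂ) (s : ℝ) (n : ℕ) (h : V → ℂ) :
    ∫ ω, Complex.exp (((s * ⟪T.posAt α (W n ω), ξ⟫ : ℝ) : ℂ) * Complex.I) * h (W n ω).1 ∂P =
      ∫ ω, Complex.exp (((s * ⟪T.posAt α (W 0 ω), ξ⟫ : ℝ) : ℂ) * Complex.I) *
        ((T.twisted (fun d => ⟪T.edgeVec α d, ξ⟫) s) ^ n) h (W 0 ω).1 ∂P := by
  induction n generalizing h with
  | zero => simp
  | succ n ih =>
    rw [hW.integral_step hcubic (fun y => Complex.exp (((s * ⟪T.posAt α y, ξ⟫ : ℝ) : ℂ) *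
      Complex.I) * h y.1) ‖h‖ (fun y => by
        rw [norm_mul, Complex.norm_exp_ofReal_mul_I, one_mul]; exact norm_le_pi_norm h _),
      pow_succ, Module.End.mul_apply, ← ih]
    refine integral_congr_ae (ae_of_all _ fun ω => ?_)
    simp only [twisted_apply]
    rw [mul_div_assoc', Finset.mul_sum]
    congr 1
    refine Finset.sum_congr rfl fun d hd => ?_
    have h1 := T.posAt_coverTgt_sub α d (W n ω).2
    rw [(T.mem_out _ d).1 hd, sub_eq_iff_eq_add] at h1
    rw [h1, inner_add_left, ← mul_assoc, ← Complex.exp_add]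
    congr 2
    push_cast
    ring

/-- The initial phase tends to 1 pointwise and all integrands have norm at most 1, so dominated
convergence handles any initial distribution, without moment conditions. -/
lemma tendsto_charFun [IsProbabilityMeasure P] (hcubic : T.IsCubic)
    (hconn : T.cover.Connected) (hbal : T.IsBalanced) (hW : T.IsSimpleRandomWalk P W) (α ξ : ℂ) :
    Tendsto (fun n : ℕ => charFun (P.map fun ω => (Real.sqrt n)⁻¹ • T.posAt α (W n ω)) ξ) atTop
      (nhds (Complex.exp
        (-(((∑ d, ⟪T.edgeVec α d, ξ⟫ ^ 2) / Fintype.card D / 2 : ℝ) : ℂ)))) := by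
  set x : D → ℝ := fun d => ⟪T.edgeVec α d, ξ⟫ with hx
  have h1 : ∀ n : ℕ, charFun (P.map fun ω => (Real.sqrt n)⁻¹ • T.posAt α (W n ω)) ξ =
      ∫ ω, Complex.exp ((((Real.sqrt n)⁻¹ * ⟪T.posAt α (W 0 ω), ξ⟫ : ℝ) : ℂ) * Complex.I) *
        ((T.twisted x (Real.sqrt n)⁻¹) ^ n) 1 (W 0 ω).1 ∂P := by
    intro n
    rw [← hW.integral_phase hcubic α ξ, charFun_apply, integral_map
      (hW.measurable_comp (fun y => (Real.sqrt n)⁻¹ • T.posAt α y) n).aemeasurable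
      (by fun_prop)]
    simp only [Pi.one_apply, mul_one, real_inner_smul_left]
  simp only [h1]
  have hs0 : Tendsto (fun n : ℕ => (Real.sqrt n)⁻¹) atTop (nhds 0) :=
    (Real.tendsto_sqrt_atTop.comp tendsto_natCast_atTop_atTop).inv_tendsto_atTop
  set L := Complex.exp (-(((∑ d, x d ^ 2) / Fintype.card D / 2 : ℝ) : ℂ)) with hL
  have h2 : L = ∫ _ : Ω, L ∂P := by simp
  rw [h2]
  refine tendsto_integral_of_dominated_convergence (fun _ => 1) (fun n => ?_)
    (integrable_const _) (fun n => ae_of_all _ fun ω => ?_) (ae_of_all _ fun ω => ?_)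
  · exact (hW.measurable_comp (fun y => Complex.exp ((((Real.sqrt n)⁻¹ * ⟪T.posAt α y, ξ⟫ : ℝ) : ℂ)
      * Complex.I) * ((T.twisted x (Real.sqrt n)⁻¹) ^ n) 1 y.1) 0).aestronglyMeasurable
  · rw [norm_mul, Complex.norm_exp_ofReal_mul_I, one_mul]
    have : Nonempty V := ⟨(W 0 ω).1⟩
    refine (norm_le_pi_norm _ _).trans ((norm_pow_apply_le _ (T.norm_twisted_le hcubic x _) n
      1).trans ?_)
    simp
  · have h3 := T.tendsto_twisted_pow hcubic hconn x (T.sum_out_inner_edgeVec hcubic hbal α ξ)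
      (W 0 ω).1
    have h4 : Continuous fun s : ℝ =>
        Complex.exp (((s * ⟪T.posAt α (W 0 ω), ξ⟫ : ℝ) : ℂ) * Complex.I) := by fun_prop
    have h5 := ((h4.tendsto 0).comp hs0).mul h3
    simpa only [Function.comp_def, zero_mul, Complex.ofReal_zero, Complex.exp_zero, one_mul] using h5

end IsSimpleRandomWalk

omit [Fintype V] [DecidableEq V] in
-- This mean of squares yields both positive semidefiniteness and the match with the variance found
-- for the walk.
lemma dotProduct_covMatrix_mulVec (T : TorusGraph V D) (α : ℂ) (x : Fin 2 → ℝ) :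
    x ⬝ᵥ (T.covMatrix α).mulVec x =
      (∑ d, ⟪T.edgeVec α d, (x 0 + x 1 * Complex.I : ℂ)⟫ ^ 2) / Fintype.card D := by
  have h : ∀ d, ⟪T.edgeVec α d, (x 0 + x 1 * Complex.I : ℂ)⟫ ^ 2 =
      (x 0) ^ 2 * (T.edgeVec α d).re ^ 2 +
      2 * x 0 * x 1 * ((T.edgeVec α d).re * (T.edgeVec α d).im) +
      (x 1) ^ 2 * (T.edgeVec α d).im ^ 2 := by
    intro d
    rw [complex_inner_eq]
    simp
    ring
  simp only [h, Finset.sum_add_distrib, ← Finset.mul_sum]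
  simp [covMatrix, dotProduct, Matrix.mulVec, Fin.sum_univ_two]
  ring

omit [Fintype V] [DecidableEq V] in
lemma posSemidef_covMatrix (T : TorusGraph V D) (α : ℂ) : (T.covMatrix α).PosSemidef := by
  refine .of_dotProduct_mulVec_nonneg ?_ fun x => ?_
  · ext i j
    fin_cases i <;> fin_cases j <;> simp [covMatrix]
  · rw [star_trivial, dotProduct_covMatrix_mulVec]
    positivity

end TorusGraph

lemma continuous_planeToComplex : Continuous planeToComplex := by
  unfold planeToComplex
  fun_prop

namespace TorusGraph

variable {V D : Type*} [Fintype V] [Fintype D] [DecidableEq V]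

open scoped RealInnerProductSpace

omit [Fintype V] [DecidableEq V] in
lemma charFun_limitLaw (T : TorusGraph V D) (α ξ : ℂ) :
    charFun (T.limitLaw α) ξ = Complex.exp
      (-(((∑ d, ⟪T.edgeVec α d, ξ⟫ ^ 2) / Fintype.card D / 2 : ℝ) : ℂ)) := by
  have h1 : charFun (T.limitLaw α) ξ =
      charFun (multivariateGaussian 0 (T.covMatrix α)) !₂[ξ.re, ξ.im] := by
    rw [limitLaw, charFun_apply, charFun_apply,
      integral_map continuous_planeToComplex.measurable.aemeasurable (by fun_prop)]
    congr 1
    ext x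
    congr 3
    rw [complex_inner_eq, PiLp.inner_apply]
    simp [planeToComplex, Fin.sum_univ_two, mul_comm]
  rw [h1, charFun_multivariateGaussian (T.posSemidef_covMatrix α)]
  have h2 := T.dotProduct_covMatrix_mulVec α ![ξ.re, ξ.im]
  simp only [Matrix.cons_val_zero, Matrix.cons_val_one, Complex.re_add_im] at h2
  rw [inner_zero_right, ← h2]
  simp

instance isProbabilityMeasure_limitLaw (T : TorusGraph V D) (α : ℂ) : IsProbabilityMeasure (T.limitLaw α) :=
  Measure.isProbabilityMeasure_map continuous_planeToComplex.measurable.aemeasurable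

/-- The central limit theorem for the simple random walk on `T_α`. -/
theorem IsSimpleRandomWalk.tendstoInDistribution {T : TorusGraph V D} {Ω : Type*}
    [MeasurableSpace Ω] {P : Measure Ω} [IsProbabilityMeasure P] {W : ℕ → Ω → T.CoverVertex}
    (hcubic : T.IsCubic) (hconn : T.cover.Connected) (hbal : T.IsBalanced)
    (hW : T.IsSimpleRandomWalk P W) (α : ℂ) :
    TendstoInDistribution
      (fun (n : ℕ) (ω : Ω) => (Real.sqrt n)⁻¹ • T.posAt α (W n ω)) atTop
      planeToComplex (fun _ => P) (multivariateGaussian 0 (T.covMatrix α)) where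
  forall_aemeasurable n :=
    (hW.measurable_comp (fun y => (Real.sqrt n)⁻¹ • T.posAt α y) n).aemeasurable
  aemeasurable_limit := continuous_planeToComplex.measurable.aemeasurable
  tendsto := by
    refine ProbabilityMeasure.tendsto_of_tendsto_charFun fun ξ => ?_
    have h := hW.tendsto_charFun hcubic hconn hbal α ξ
    rw [← T.charFun_limitLaw] at h
    exact h

end TorusGraph

/-! ### Isotropy and the distinguished modulus. -/

namespace TorusGraph

variable {V D : Type*} [Fintype V] [Fintype D] [DecidableEq V]

open scoped RealInnerProductSpace

omit [Fintype V] in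
lemma nonempty_dart (T : TorusGraph V D) (hcubic : T.IsCubic) (hconn : T.cover.Connected) :
    Nonempty D := by
  have h : (T.out hconn.nonempty.some.1).Nonempty := by
    rw [← Finset.card_pos, hcubic]; norm_num
  exact ⟨h.choose⟩

omit [Fintype V] [DecidableEq V] in
lemma sum_edgeVec_sq_eq_zero_iff (T : TorusGraph V D) (α : ℂ) :
    ∑ e, T.edgeVec α e ^ 2 = 0 ↔
      ∑ e, (T.edgeVec α e).re ^ 2 = ∑ e, (T.edgeVec α e).im ^ 2 ∧
      ∑ e, (T.edgeVec α e).re * (T.edgeVec α e).im = 0 := by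
  have hre : ∀ z : ℂ, (z ^ 2).re = z.re ^ 2 - z.im ^ 2 := fun z => by
    rw [sq, Complex.mul_re]; ring
  have him : ∀ z : ℂ, (z ^ 2).im = 2 * (z.re * z.im) := fun z => by
    rw [sq, Complex.mul_im]; ring
  rw [Complex.ext_iff, Complex.re_sum, Complex.im_sum]
  simp only [hre, him, Finset.sum_sub_distrib, ← Finset.mul_sum, Complex.zero_re,
    Complex.zero_im, sub_eq_zero, mul_eq_zero, two_ne_zero, false_or]

omit [Fintype V] in
lemma covMatrix_scalar_iff (T : TorusGraph V D) (hcubic : T.IsCubic) (hconn : T.cover.Connected)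
    (α : ℂ) : (∃ c : ℝ, T.covMatrix α = c • (1 : Matrix (Fin 2) (Fin 2) ℝ)) ↔
      ∑ e, T.edgeVec α e ^ 2 = 0 := by
  have := T.nonempty_dart hcubic hconn
  have hD : (Fintype.card D : ℝ) ≠ 0 := by simp
  rw [sum_edgeVec_sq_eq_zero_iff]
  constructor
  · rintro ⟨c, hc⟩
    have h00 := congrFun (congrFun hc 0) 0
    have h11 := congrFun (congrFun hc 1) 1
    have h01 := congrFun (congrFun hc 0) 1
    simp only [covMatrix, Matrix.of_apply, Matrix.cons_val', Matrix.cons_val_zero,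
      Matrix.cons_val_one, Matrix.smul_apply, Matrix.one_apply_eq, smul_eq_mul, mul_one,
      ne_eq, zero_ne_one, not_false_eq_true, Matrix.one_apply_ne, mul_zero,
      Matrix.cons_val_fin_one] at h00 h11 h01
    refine ⟨?_, ?_⟩
    · rw [div_eq_iff hD] at h00 h11
      rw [h00, h11]
    · rw [div_eq_iff hD] at h01
      rw [h01, zero_mul]
  · rintro ⟨h1, h2⟩
    refine ⟨(∑ e, (T.edgeVec α e).im ^ 2) / Fintype.card D, ?_⟩
    ext i j
    fin_cases i <;> fin_cases j <;> simp [covMatrix, h1, h2]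

omit [Fintype V] [DecidableEq V] in
lemma sum_inner_edgeVec_sq (T : TorusGraph V D) (α ξ : ℂ) :
    ∑ d, ⟪T.edgeVec α d, ξ⟫ ^ 2 = ξ.re ^ 2 * ∑ e, (T.edgeVec α e).re ^ 2 +
      2 * ξ.re * ξ.im * ∑ e, (T.edgeVec α e).re * (T.edgeVec α e).im +
      ξ.im ^ 2 * ∑ e, (T.edgeVec α e).im ^ 2 := by
  simp only [Finset.mul_sum, ← Finset.sum_add_distrib]
  refine Finset.sum_congr rfl fun d _ => ?_
  rw [complex_inner_eq]
  ring

omit [Fintype V] in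
-- A rotation of the law by `u` rotates the argument of its characteristic function by the conjugate
-- of `u`, so only the invariance of the quadratic form in the exponent is at stake.
lemma isIsotropic_limitLaw_iff (T : TorusGraph V D) (hcubic : T.IsCubic)
    (hconn : T.cover.Connected) (α : ℂ) :
    IsIsotropic (T.limitLaw α) ↔ ∑ e, T.edgeVec α e ^ 2 = 0 := by
  have := T.nonempty_dart hcubic hconn
  have hD : (Fintype.card D : ℝ) ≠ 0 := by simp
  have hrot : ∀ u ξ : ℂ, charFun ((T.limitLaw α).map fun z => u * z) ξ =
      charFun (T.limitLaw α) ((starRingEnd ℂ) u * ξ) := by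
    intro u ξ
    rw [charFun_apply, charFun_apply, integral_map (by fun_prop) (by fun_prop)]
    refine integral_congr_ae (ae_of_all _ fun z => ?_)
    simp only
    congr 3
    simp only [complex_inner_eq, Complex.mul_re, Complex.mul_im, Complex.conj_re, Complex.conj_im]
    ring
  rw [sum_edgeVec_sq_eq_zero_iff]
  constructor
  · intro h
    have key : ∀ u : ℂ, ‖u‖ = 1 → ∑ d, ⟪T.edgeVec α d, (starRingEnd ℂ) u⟫ ^ 2 =
        ∑ d, ⟪T.edgeVec α d, (1 : ℂ)⟫ ^ 2 := by
      intro u hu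
      have h1 := hrot u 1
      rw [h u hu, charFun_limitLaw, charFun_limitLaw, mul_one, ← Complex.ofReal_neg,
        ← Complex.ofReal_neg, ← Complex.ofReal_exp, ← Complex.ofReal_exp, Complex.ofReal_inj,
        Real.exp_eq_exp, neg_inj, div_left_inj' two_ne_zero, div_left_inj' hD] at h1
      exact h1.symm
    -- The quarter turn equates the diagonal coefficients; any rotation mixing both axes, such as
    -- the 3-4-5 one below, then kills the cross term.
    have hI := key Complex.I (by simp)
    have h2 := key ⟨3 / 5, -(4 / 5)⟩ (by
      rw [Complex.norm_def, Complex.normSq_mk]; norm_num)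
    simp only [sum_inner_edgeVec_sq, Complex.conj_re, Complex.conj_im, Complex.I_re, Complex.I_im,
      Complex.one_re, Complex.one_im] at hI h2
    constructor <;> linarith
  · rintro ⟨h1, h2⟩ u hu
    have : IsProbabilityMeasure ((T.limitLaw α).map fun z => u * z) :=
      Measure.isProbabilityMeasure_map (by fun_prop)
    refine Measure.ext_of_charFun (funext fun ξ => ?_)
    rw [hrot, charFun_limitLaw, charFun_limitLaw]
    congr 5
    simp only [sum_inner_edgeVec_sq, h1, h2]
    have hu2 : u.re * u.re + u.im * u.im = 1 := by
      rw [← Complex.normSq_apply, Complex.normSq_eq_norm_sq, hu, one_pow]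
    simp only [Complex.mul_re, Complex.mul_im, Complex.conj_re, Complex.conj_im]
    linear_combination (∑ e, (T.edgeVec α e).im ^ 2) * (ξ.re ^ 2 + ξ.im ^ 2) * hu2

omit [Fintype V] [DecidableEq V] in
/-- The edges of the square embedding are not all orthogonal to a given direction. -/
lemma sum_sq_pos (T : TorusGraph V D) (hconn : T.cover.Connected) (s t : ℝ)
    (hst : s ≠ 0 ∨ t ≠ 0) :
    0 < ∑ d, (s * (T.squareVec d).re + t * (T.squareVec d).im) ^ 2 := by
  refine lt_of_le_of_ne (Finset.sum_nonneg fun _ _ => sq_nonneg _) fun h => ?_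
  have h0 := (Finset.sum_eq_zero_iff_of_nonneg (fun d _ => sq_nonneg _)).1 h.symm
  have hinv := T.eq_of_edge_invariant hconn
    (fun x => s * (T.squarePos x).re + t * (T.squarePos x).im) (fun d k => by
      have h1 := pow_eq_zero_iff two_ne_zero |>.1 (h0 d (Finset.mem_univ d))
      rw [← T.squarePos_coverTgt_sub d k, Complex.sub_re, Complex.sub_im] at h1
      linarith)
  let v := hconn.nonempty.some.1
  -- An invariant linear form takes equal values at translates by the two periods, along which it
  -- changes by `s` and `t`.
  have h1 := hinv (v, (1, 0)) (v, 0)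
  have h2 := hinv (v, (0, 1)) (v, 0)
  simp [squarePos, mul_add] at h1 h2
  tauto

omit [Fintype V] [DecidableEq V] in
lemma existsUnique_modulus (T : TorusGraph V D) (hconn : T.cover.Connected) :
    ∃! a : ℂ, 0 < a.im ∧
      ∀ α : ℂ, ∑ e : D, T.edgeVec α e ^ 2 = 0 ↔ α = a ∨ α = (starRingEnd ℂ) a := by
  set A := ∑ d, (T.squareVec d).re ^ 2 with hA
  set B := ∑ d, (T.squareVec d).re * (T.squareVec d).im with hB
  set C := ∑ d, (T.squareVec d).im ^ 2 with hC
  have hquad : ∀ s t : ℝ, ∑ d, (s * (T.squareVec d).re + t * (T.squareVec d).im) ^ 2 =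
      s ^ 2 * A + 2 * s * t * B + t ^ 2 * C := by
    intro s t
    simp only [hA, hB, hC, Finset.mul_sum, ← Finset.sum_add_distrib]
    exact Finset.sum_congr rfl fun _ _ => by ring
  have hsum : ∀ α : ℂ, ∑ e : D, T.edgeVec α e ^ 2 = A + 2 * α * B + α ^ 2 * C := by
    intro α
    simp only [hA, hB, hC]
    push_cast
    simp only [Finset.mul_sum, ← Finset.sum_add_distrib]
    exact Finset.sum_congr rfl fun _ _ => by rw [edgeVec_eq]; ring
  have hCpos : 0 < C := by
    have := T.sum_sq_pos hconn 0 1 (by simp)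
    rw [hquad] at this
    linarith
  have hdisc : 0 < A * C - B ^ 2 := by
    -- At (C, -B) the quadratic form equals C (AC - B²).
    have := T.sum_sq_pos hconn C (-B) (Or.inl hCpos.ne')
    rw [hquad] at this
    have h2 : 0 < C * (A * C - B ^ 2) := by linarith
    exact pos_of_mul_pos_right h2 hCpos.le
  set r := Real.sqrt (A * C - B ^ 2) with hr
  have hr2 : (r : ℂ) ^ 2 = A * C - B ^ 2 := by exact_mod_cast Real.sq_sqrt hdisc.le
  have hrpos : 0 < r := Real.sqrt_pos.2 hdisc
  have hC0 : (C : ℂ) ≠ 0 := by exact_mod_cast hCpos.ne'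
  set a : ℂ := ⟨-B / C, r / C⟩ with ha
  have ha1 : a = (-B + r * Complex.I) / C := by
    rw [ha, Complex.mk_eq_add_mul_I]; push_cast; ring
  have ha2 : (starRingEnd ℂ) a = (-B - r * Complex.I) / C := by
    rw [ha1]; simp [sub_eq_add_neg]
  have hroot : ∀ α : ℂ, ∑ e : D, T.edgeVec α e ^ 2 = 0 ↔ α = a ∨ α = (starRingEnd ℂ) a := by
    intro α
    have hfac : (A + 2 * α * B + α ^ 2 * C : ℂ) = C * ((α - a) * (α - (starRingEnd ℂ) a)) := by
      rw [ha2, ha1]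
      field_simp
      linear_combination -hr2 + (r : ℂ) ^ 2 * Complex.I_sq
    rw [hsum, hfac, mul_eq_zero, mul_eq_zero, sub_eq_zero, sub_eq_zero]
    simp [hC0]
  refine ⟨a, ⟨div_pos hrpos hCpos, hroot⟩, ?_⟩
  rintro b ⟨hb, hb2⟩
  rcases (hroot b).1 ((hb2 b).2 (Or.inl rfl)) with h | h
  · exact h
  · have h1 : b.im = -(r / C) := by rw [h, Complex.conj_im]
    have : 0 < r / C := div_pos hrpos hCpos
    linarith

end TorusGraph

theorem mainTheorem3 {V D : Type*} [Fintype V] [Fintype D] [DecidableEq V]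
    (T : TorusGraph V D) (hcubic : T.IsCubic) (hconn : T.cover.Connected)
    (hbal : T.IsBalanced) :
    -- central limit theorem for the walk `Z n = T.posAt α (W n)` on `T_α`
    (∀ α : ℂ, α.im ≠ 0 →
      ∀ (Ω : Type*) [MeasurableSpace Ω] (P : Measure Ω) [IsProbabilityMeasure P]
        (W : ℕ → Ω → T.CoverVertex), T.IsSimpleRandomWalk P W →
        TendstoInDistribution
          (fun (n : ℕ) (ω : Ω) => (Real.sqrt n)⁻¹ • T.posAt α (W n ω)) atTop
          planeToComplex (fun _ => P) (multivariateGaussian 0 (T.covMatrix α))) ∧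
    -- isotropy of the limit
    (∀ α : ℂ, α.im ≠ 0 →
      (IsIsotropic (T.limitLaw α) ↔ ∑ e : D, T.edgeVec α e ^ 2 = 0) ∧
      ((∃ c : ℝ, T.covMatrix α = c • (1 : Matrix (Fin 2) (Fin 2) ℝ)) ↔
        ∑ e : D, T.edgeVec α e ^ 2 = 0)) ∧
    -- the unique conjugate pair of moduli
    (∃! a : ℂ, 0 < a.im ∧
      ∀ α : ℂ, ∑ e : D, T.edgeVec α e ^ 2 = 0 ↔ α = a ∨ α = (starRingEnd ℂ) a) :=
  ⟨fun α _ _ _ _ _ _ hW => hW.tendstoInDistribution hcubic hconn hbal α,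
    fun α _ => ⟨T.isIsotropic_limitLaw_iff hcubic hconn α, T.covMatrix_scalar_iff hcubic hconn α⟩,
    T.existsUnique_modulus hconn⟩
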